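/- Let $\mathbb K=\mathbb R$ or $\mathbb C$ and let $n\ge 3$. Let $\mathcal F(\mathbb K^n)$ be one of the following algebras: the formal power series $\mathbb K[[x_1,\dots,x_n]]$ (formal case); the germs at $0$ of $\mathbb K$-analytic functions on $\mathbb K^n$, i.e. real analytic functions if $\mathbb K=\mathbb R$ and holomorphic functions if $\mathbb K=\mathbb C$ (analytic case); or, for $\mathbb K=\mathbb R$, the germs at $0$ of $C^\infty$ functions on $\mathbb R^n$ ($C^\infty$ case). Let $\Omega^k(\mathbb K^n)$ be the module of $k$-forms $\sum_{i_1<\dots<i_k} a_{i_1\dots i_k}\,dx_{i_1}\wedge\dots\wedge dx_{i_k}$ with coefficients in $\mathcal F(\mathbb K^n)$. Let $f\in\mathbb K[x_1,\dots,x_n]$ be a polynomial with $f(0)=0$ that is quasihomogeneous of degree $N\in\mathbb Z$ with respect to positive integer weights $w_1,\dots,w_n$, i.e. $\sum_i w_i x_i\,\frac{\partial f}{\partial x_i}=N f$. Let $I_f\subset\mathcal F(\mathbb K^n)$ be the ideal generated by $\frac{\partial f}{\partial x_1},\dots,\frac{\partial f}{\partial x_n}$, and suppose that $f$ is of finite codimension,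 i.e. that the Milnor algebra $Q_f=\mathcal F(\mathbb K^n)/I_f$ is a finite-dimensional $\mathbb K$-vector space. For $p\in\mathbb Z$ let $H^k_{f,p}(\mathbb K^n)$ be the cohomology in degree $k$ of the complex $\Omega^\bullet(\mathbb K^n)$ with differential $$d_f^{(p)}:\Omega^k(\mathbb K^n)\to\Omega^{k+1}(\mathbb K^n),\qquad \alpha\mapsto f\,d\alpha-(k-p)\,df\wedge\alpha .$$ Then, in each of the three cases, for every integer $q\le 0$, the $\mathbb K$-vector spaces $H^n_{f,n-q}(\mathbb K^n)$ and $Q_f$ are isomorphic. -/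

import Mathlib

open Filter Topology
open scoped ContDiff

noncomputable section

namespace NambuPoisson

/-! ### Differential forms in coordinates

`R` is a ring of functions (or germs, or formal power series) in the coordinates `x₁, …, xₙ`, and
`D i` is the partial derivative with respect to `xᵢ`. -/

section Forms

variable {𝕜 R : Type*} [Field 𝕜] [CommRing R] [Algebra 𝕜 R] {n : ℕ}

/-- The module `Ωᵏ` of `k`-forms with coefficients in `R`. The form `α` stands for
`∑ α I • dx_{I 0} ∧ ⋯ ∧ dx_{I (k-1)}`, the sum being over strictly increasing multi-indices `I`. -/
abbrev Form (R : Type*) (n k : ℕ) : Type _ := (Fin k ↪o Fin n) → R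

/-- The multi-index `J` with its `j`-th entry removed. -/
def dropIndex {k : ℕ} (J : Fin (k + 1) ↪o Fin n) (j : Fin (k + 1)) : Fin k ↪o Fin n :=
  (Fin.succAboveOrderEmb j).trans J

/-- The exterior derivative `d : Ωᵏ → Ωᵏ⁺¹`,
`d (∑ a_I dx_I) = ∑ᵢ ∑_I (∂ᵢ a_I) dxᵢ ∧ dx_I`. -/
def extD (D : Fin n → Derivation 𝕜 R R) (k : ℕ) : Form R n k →ₗ[𝕜] Form R n (k + 1) where
  toFun α := fun J => ∑ j : Fin (k + 1), (-1 : R) ^ (j : ℕ) * D (J j) (α (dropIndex J j))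
  map_add' α β := by
    funext J
    simp [mul_add, Finset.sum_add_distrib]
  map_smul' c α := by
    funext J
    simp [Finset.smul_sum]

/-- The exterior product `η ∧ ·` with the `1`-form `η = ∑ η i • dxᵢ`. -/
def wedge1 (𝕜 : Type*) {R : Type*} [Field 𝕜] [CommRing R] [Algebra 𝕜 R] {n : ℕ}
    (η : Fin n → R) (k : ℕ) : Form R n k →ₗ[𝕜] Form R n (k + 1) where
  toFun α := fun J => ∑ j : Fin (k + 1), (-1 : R) ^ (j : ℕ) * (η (J j) * α (dropIndex J j))
  map_add' α β := by
    funext J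
    simp [mul_add, Finset.sum_add_distrib]
  map_smul' c α := by
    funext J
    simp [Finset.smul_sum]

/-- The operator `d_f^{(p)} : Ωᵏ → Ωᵏ⁺¹`, `α ↦ f dα - (k - p) df ∧ α`. -/
def dOp (D : Fin n → Derivation 𝕜 R R) (f : R) (p : ℤ) (k : ℕ) :
    Form R n k →ₗ[𝕜] Form R n (k + 1) :=
  (LinearMap.mulLeft 𝕜 f).compLeft _ ∘ₗ extD D k
    - ((k : ℤ) - p) • wedge1 𝕜 (fun i => D i f) k

/-- The space `Zᵏ_{f,p}` of `k`-cocycles of `d_f^{(p)}`. -/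
def cocycles (D : Fin n → Derivation 𝕜 R R) (f : R) (p : ℤ) (k : ℕ) :
    Submodule 𝕜 (Form R n k) :=
  LinearMap.ker (dOp D f p k)

/-- The space `Bᵏ_{f,p}` of `k`-coboundaries of `d_f^{(p)}`. -/
def coboundaries (D : Fin n → Derivation 𝕜 R R) (f : R) (p : ℤ) :
    (k : ℕ) → Submodule 𝕜 (Form R n k)
  | 0 => ⊥
  | k + 1 => LinearMap.range (dOp D f p k)

/-- The cohomology space `Hᵏ_{f,p} = Zᵏ_{f,p} / Bᵏ_{f,p}`. -/
abbrev Cohomology (R : Type*) [CommRing R] [Algebra 𝕜 R]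
    (D : Fin n → Derivation 𝕜 R R) (f : R) (p : ℤ) (k : ℕ) : Type _ :=
  cocycles D f p k ⧸ (coboundaries D f p k).comap (cocycles D f p k).subtype

/-- The ideal `I_f` generated by the partial derivatives of `f`. -/
def jacobianIdeal (D : Fin n → Derivation 𝕜 R R) (f : R) : Ideal R :=
  Ideal.span (Set.range fun i => D i f)

/-- The Milnor algebra `Q_f = R / I_f`. -/
abbrev MilnorAlgebra (R : Type*) [CommRing R] [Algebra 𝕜 R]
    (D : Fin n → Derivation 𝕜 R R) (f : R) : Type _ :=
  R ⧸ jacobianIdeal D f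

end Forms

/-! ### Germs at the origin -/

section Germs

variable (𝕜 : Type*) [NontriviallyNormedField 𝕜] (n : ℕ)

/-- Germs at `0` of arbitrary functions `𝕜ⁿ → 𝕜`. -/
abbrev AllGerms : Type _ := Germ (𝓝 (0 : Fin n → 𝕜)) 𝕜

instance : Algebra 𝕜 (AllGerms 𝕜 n) :=
  Algebra.ofModule
    (fun r x y => Germ.inductionOn₂ x y fun f g =>
      congrArg (Germ.ofFun (l := 𝓝 (0 : Fin n → 𝕜))) (smul_mul_assoc r f g))
    (fun r x y => Germ.inductionOn₂ x y fun f g =>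
      congrArg (Germ.ofFun (l := 𝓝 (0 : Fin n → 𝕜))) (mul_smul_comm r f g))

variable {𝕜 n}

/-- The partial derivative of a germ: the germ of `x ↦ (∂g/∂xᵢ)(x)`, where `g` is any
representative. -/
def germPderiv (i : Fin n) (φ : AllGerms 𝕜 n) : AllGerms 𝕜 n :=
  Quotient.liftOn' φ (fun g => ((fun x => fderiv 𝕜 g x (Pi.single i 1) :
      (Fin n → 𝕜) → 𝕜) : AllGerms 𝕜 n)) fun g h hgh => by
    have h' : g =ᶠ[𝓝 (0 : Fin n → 𝕜)] h := hgh
    exact Germ.coe_eq.2 ((h'.fderiv (𝕜 := 𝕜)).mono fun x hx => by simp only [hx])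

theorem germPderiv_coe (i : Fin n) (g : (Fin n → 𝕜) → 𝕜) :
    germPderiv i (g : AllGerms 𝕜 n)
      = ((fun x => fderiv 𝕜 g x (Pi.single i 1) : (Fin n → 𝕜) → 𝕜) : AllGerms 𝕜 n) := rfl

theorem germPderiv_add (i : Fin n) {g h : (Fin n → 𝕜) → 𝕜}
    (hg : ∀ᶠ x in 𝓝 (0 : Fin n → 𝕜), DifferentiableAt 𝕜 g x)
    (hh : ∀ᶠ x in 𝓝 (0 : Fin n → 𝕜), DifferentiableAt 𝕜 h x) :
    germPderiv i ((g : AllGerms 𝕜 n) + (h : AllGerms 𝕜 n))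
      = germPderiv i (g : AllGerms 𝕜 n) + germPderiv i (h : AllGerms 𝕜 n) := by
  rw [← Germ.coe_add, germPderiv_coe, germPderiv_coe, germPderiv_coe, ← Germ.coe_add]
  refine Germ.coe_eq.2 ?_
  filter_upwards [hg, hh] with x h1 h2
  simp [fderiv_add h1 h2]

theorem germPderiv_smul (i : Fin n) (c : 𝕜) {g : (Fin n → 𝕜) → 𝕜}
    (hg : ∀ᶠ x in 𝓝 (0 : Fin n → 𝕜), DifferentiableAt 𝕜 g x) :
    germPderiv i (c • (g : AllGerms 𝕜 n)) = c • germPderiv i (g : AllGerms 𝕜 n) := by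
  rw [← Germ.coe_smul, germPderiv_coe, germPderiv_coe, ← Germ.coe_smul]
  refine Germ.coe_eq.2 ?_
  filter_upwards [hg] with x h1
  simp [fderiv_const_smul h1]

theorem germPderiv_mul (i : Fin n) {g h : (Fin n → 𝕜) → 𝕜}
    (hg : ∀ᶠ x in 𝓝 (0 : Fin n → 𝕜), DifferentiableAt 𝕜 g x)
    (hh : ∀ᶠ x in 𝓝 (0 : Fin n → 𝕜), DifferentiableAt 𝕜 h x) :
    germPderiv i ((g : AllGerms 𝕜 n) * (h : AllGerms 𝕜 n))
      = (g : AllGerms 𝕜 n) * germPderiv i (h : AllGerms 𝕜 n)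
        + (h : AllGerms 𝕜 n) * germPderiv i (g : AllGerms 𝕜 n) := by
  rw [← Germ.coe_mul, germPderiv_coe, germPderiv_coe, germPderiv_coe, ← Germ.coe_mul,
    ← Germ.coe_mul, ← Germ.coe_add]
  refine Germ.coe_eq.2 ?_
  filter_upwards [hg, hh] with x h1 h2
  simp [fderiv_mul h1 h2]

variable (𝕜 n)

/-- The algebra of germs at `0` of `𝕜`-analytic functions on `𝕜ⁿ` (real analytic functions
if `𝕜 = ℝ`, holomorphic functions if `𝕜 = ℂ`). -/
def AnalyticGerms : Subalgebra 𝕜 (AllGerms 𝕜 n) where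
  carrier := {φ | ∃ g : (Fin n → 𝕜) → 𝕜, AnalyticAt 𝕜 g 0 ∧ (g : AllGerms 𝕜 n) = φ}
  mul_mem' := by
    rintro _ _ ⟨g, hg, rfl⟩ ⟨h, hh, rfl⟩
    exact ⟨g * h, hg.mul hh, rfl⟩
  add_mem' := by
    rintro _ _ ⟨g, hg, rfl⟩ ⟨h, hh, rfl⟩
    exact ⟨g + h, hg.add hh, rfl⟩
  algebraMap_mem' c := by
    refine ⟨c • 1, analyticAt_const (v := c • (1 : 𝕜)), ?_⟩
    rw [Algebra.algebraMap_eq_smul_one]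
    rfl

/-- The algebra of germs at `0` of real `C^∞` functions on `ℝⁿ`. -/
def SmoothGerms : Subalgebra ℝ (AllGerms ℝ n) where
  carrier := {φ | ∃ g : (Fin n → ℝ) → ℝ,
    (∀ᶠ x in 𝓝 (0 : Fin n → ℝ), ContDiffAt ℝ ∞ g x) ∧ (g : AllGerms ℝ n) = φ}
  mul_mem' := by
    rintro _ _ ⟨g, hg, rfl⟩ ⟨h, hh, rfl⟩
    exact ⟨g * h, by filter_upwards [hg, hh] with x h1 h2 using h1.mul h2, rfl⟩
  add_mem' := by
    rintro _ _ ⟨g, hg, rfl⟩ ⟨h, hh, rfl⟩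
    exact ⟨g + h, by filter_upwards [hg, hh] with x h1 h2 using h1.add h2, rfl⟩
  algebraMap_mem' c := by
    refine ⟨c • 1, Eventually.of_forall fun x => contDiffAt_const (c := c • (1 : ℝ)), ?_⟩
    rw [Algebra.algebraMap_eq_smul_one]
    rfl

variable {𝕜 n}

theorem eventually_differentiableAt_of_analytic [CompleteSpace 𝕜] {g : (Fin n → 𝕜) → 𝕜} (hg : AnalyticAt 𝕜 g 0) :
    ∀ᶠ x in 𝓝 (0 : Fin n → 𝕜), DifferentiableAt 𝕜 g x :=
  hg.eventually_analyticAt.mono fun _ hx => hx.differentiableAt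

theorem eventually_differentiableAt_of_smooth {g : (Fin n → ℝ) → ℝ}
    (hg : ∀ᶠ x in 𝓝 (0 : Fin n → ℝ), ContDiffAt ℝ ∞ g x) :
    ∀ᶠ x in 𝓝 (0 : Fin n → ℝ), DifferentiableAt ℝ g x :=
  hg.mono fun _ hx => hx.differentiableAt (by simp)

/-- The partial derivative `∂/∂xᵢ` on germs of analytic functions. -/
def analyticPderiv (𝕜 : Type*) [NontriviallyNormedField 𝕜] [CompleteSpace 𝕜] {n : ℕ} (i : Fin n) :
    Derivation 𝕜 (AnalyticGerms 𝕜 n) (AnalyticGerms 𝕜 n) :=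
  Derivation.mk'
    { toFun := fun φ => ⟨germPderiv i φ.1, by
        obtain ⟨_, g, hg, rfl⟩ := φ
        exact ⟨_, ((ContinuousLinearMap.apply 𝕜 𝕜 (Pi.single i 1 : Fin n → 𝕜)).analyticAt _).comp hg.fderiv,
          rfl⟩⟩
      map_add' := by
        rintro ⟨_, g, hg, rfl⟩ ⟨_, h, hh, rfl⟩
        exact Subtype.ext (germPderiv_add i (eventually_differentiableAt_of_analytic hg)
          (eventually_differentiableAt_of_analytic hh))
      map_smul' := by
        rintro c ⟨_, g, hg, rfl⟩
        exact Subtype.ext (germPderiv_smul i c (eventually_differentiableAt_of_analytic hg)) }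
    (by
      rintro ⟨_, g, hg, rfl⟩ ⟨_, h, hh, rfl⟩
      exact Subtype.ext (germPderiv_mul i (eventually_differentiableAt_of_analytic hg)
        (eventually_differentiableAt_of_analytic hh)))

/-- The partial derivative `∂/∂xᵢ` on germs of `C^∞` functions. -/
def smoothPderiv {n : ℕ} (i : Fin n) : Derivation ℝ (SmoothGerms n) (SmoothGerms n) :=
  Derivation.mk'
    { toFun := fun φ => ⟨germPderiv i φ.1, by
        obtain ⟨_, g, hg, rfl⟩ := φ
        exact ⟨_, hg.mono fun x hx =>
          (hx.fderiv_right (m := ∞) (by simp)).clm_apply contDiffAt_const, rfl⟩⟩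
      map_add' := by
        rintro ⟨_, g, hg, rfl⟩ ⟨_, h, hh, rfl⟩
        exact Subtype.ext (germPderiv_add i (eventually_differentiableAt_of_smooth hg)
          (eventually_differentiableAt_of_smooth hh))
      map_smul' := by
        rintro c ⟨_, g, hg, rfl⟩
        exact Subtype.ext (germPderiv_smul i c (eventually_differentiableAt_of_smooth hg)) }
    (by
      rintro ⟨_, g, hg, rfl⟩ ⟨_, h, hh, rfl⟩
      exact Subtype.ext (germPderiv_mul i (eventually_differentiableAt_of_smooth hg)
        (eventually_differentiableAt_of_smooth hh)))

/-- The analytic germ at `0` of a polynomial. -/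
def analyticGerm [CompleteSpace 𝕜] (f : MvPolynomial (Fin n) 𝕜) : AnalyticGerms 𝕜 n :=
  ⟨((fun x => MvPolynomial.eval x f : (Fin n → 𝕜) → 𝕜) : AllGerms 𝕜 n), _,
    AnalyticOnNhd.eval_mvPolynomial f 0 trivial, rfl⟩

/-- The `C^∞` germ at `0` of a real polynomial. -/
def smoothGerm (f : MvPolynomial (Fin n) ℝ) : SmoothGerms n :=
  ⟨((fun x => MvPolynomial.eval x f : (Fin n → ℝ) → ℝ) : AllGerms ℝ n), _,
    Eventually.of_forall fun x => (AnalyticOnNhd.eval_mvPolynomial f x trivial).contDiffAt, rfl⟩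

end Germs

/-- The polynomial `f` is quasihomogeneous of degree `N` with weights `w`: `W.f = N f`, where
`W = ∑ wᵢ xᵢ ∂/∂xᵢ`. -/
def IsQuasihomogeneous {𝕜 : Type*} [Field 𝕜] {n : ℕ} (w : Fin n → ℕ) (N : ℤ)
    (f : MvPolynomial (Fin n) 𝕜) : Prop :=
  ∑ i, (w i : MvPolynomial (Fin n) 𝕜) * MvPolynomial.X i * MvPolynomial.pderiv i f
    = (N : MvPolynomial (Fin n) 𝕜) * f

end NambuPoisson

end

namespace NambuPoisson

/-! ### Algebraic reduction to solvability of a weighted Euler equation -/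

section Algebra

variable {𝕜 R : Type*} [Field 𝕜] [CommRing R] [Algebra 𝕜 R]

/-! In top degree every form is a cocycle, and an `n`-form is a single function, so everything rests
on identifying the coboundaries with `I_f`. Contracting the volume form turns an `(n-1)`-form into a
vector field `X`, and the differential becomes `X ↦ f div X + c X(f)` with `c = 1 - q > 0`.

This image lies in `I_f`, because `N f = W f` puts `f` itself in `I_f` (`W = ∑ wᵢ xᵢ ∂ᵢ`, `N > 0`
when `f ≠ 0`). Conversely, for `r = ∑ aᵢ ∂ᵢf` the field `Y = a / c` gives `r + f div Y`. The error
is removed with a multiple `g W` of the Euler field, which contributes `f (W g + l g)` with `l = ∑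
wᵢ + c N > 0`. So it suffices to solve `W g + l g = h` for every `h`
(`exists_twistedDivergence_eq_iff`).

Only this last step depends on the function algebra. On power series `W` is diagonal in the
monomials, with nonnegative eigenvalues. On germs, `g(x) = ∫₀¹ t^(l-1) h(t^w x) dt` is a solution
(`fderiv_weightedAverage_add`), and it is analytic or smooth when `h` is. -/

theorem derivation_algHom_eq_pderiv {σ : Type*} (φ : MvPolynomial σ 𝕜 →ₐ[𝕜] R)
    (i : σ) (D : Derivation 𝕜 R R) [DecidableEq σ]
    (hφ : ∀ j, D (φ (MvPolynomial.X j)) = if i = j then 1 else 0) (p : MvPolynomial σ 𝕜) :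
    D (φ p) = φ (MvPolynomial.pderiv i p) := by
  induction p using MvPolynomial.induction_on with
  | C a =>
    rw [← MvPolynomial.algebraMap_eq, AlgHom.commutes, Derivation.map_algebraMap,
      Derivation.map_algebraMap, map_zero]
  | add p q hp hq => simp only [map_add, hp, hq]
  | mul_X p j hp =>
    simp only [map_mul, Derivation.leibniz, hp, hφ, smul_eq_mul, map_add, MvPolynomial.pderiv_X,
      Pi.single_apply, eq_comm (a := j)]
    split_ifs <;> simp

/-- Monomials are eigenvectors of the Euler field, with their weighted degree as eigenvalue. -/
theorem coeff_weighted_euler {σ : Type*} [Fintype σ] (w : σ → ℕ) (g : MvPowerSeries σ 𝕜)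
    (d : σ →₀ ℕ) :
    MvPowerSeries.coeff d (∑ i, (w i : MvPowerSeries σ 𝕜) * MvPowerSeries.X i
      * MvPowerSeries.pderiv 𝕜 i g) = (∑ i, (w i : 𝕜) * d i) * MvPowerSeries.coeff d g := by
  classical
  rw [map_sum, Finset.sum_mul]
  refine Finset.sum_congr rfl fun i _ => ?_
  have hc : (w i : MvPowerSeries σ 𝕜) = MvPowerSeries.C (w i : 𝕜) := by simp
  rw [hc, mul_assoc, MvPowerSeries.coeff_C_mul, MvPowerSeries.X, MvPowerSeries.coeff_monomial_mul]
  split_ifs with h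
  · have hd : 1 ≤ d i := by simpa using h i
    rw [MvPowerSeries.coeff_pderiv, tsub_add_cancel_of_le h]
    simp [Nat.cast_sub hd]
    ring
  · have hd : d i = 0 := by
      by_contra hd
      exact h (Finsupp.single_le_iff.2 (Nat.one_le_iff_ne_zero.2 hd))
    simp [hd]

theorem exists_weighted_euler_add_formal [CharZero 𝕜] {σ : Type*} [Fintype σ] (w : σ → ℕ) {l : ℕ}
    (hl : 0 < l) (h : MvPowerSeries σ 𝕜) :
    ∃ g : MvPowerSeries σ 𝕜, ∑ i, (w i : MvPowerSeries σ 𝕜) * MvPowerSeries.X i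
      * MvPowerSeries.pderiv 𝕜 i g + l * g = h := by
  -- Each eigenvalue of `W + l` is a positive integer, hence invertible in characteristic zero.
  let g : MvPowerSeries σ 𝕜 := fun d => (∑ i, (w i : 𝕜) * d i + l)⁻¹ * MvPowerSeries.coeff d h
  have hg : ∀ d, MvPowerSeries.coeff d g
      = (∑ i, (w i : 𝕜) * d i + l)⁻¹ * MvPowerSeries.coeff d h := fun _ => rfl
  refine ⟨g, ?_⟩
  ext d
  have hc : (l : MvPowerSeries σ 𝕜) = MvPowerSeries.C (l : 𝕜) := by simp
  have hne : (∑ i, (w i : 𝕜) * d i + l) ≠ 0 := by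
    have : (∑ i, w i * d i + l : ℕ) ≠ 0 := by omega
    exact_mod_cast this
  rw [map_add, coeff_weighted_euler, hc, MvPowerSeries.coeff_C_mul, ← add_mul, hg,
    mul_inv_cancel_left₀ hne]

/-- A nonzero `f` vanishing at the origin contains a nonconstant monomial, whose weighted degree
must equal `N`. -/
theorem IsQuasihomogeneous.degree_pos [CharZero 𝕜] {n : ℕ} {w : Fin n → ℕ} (hw : ∀ i, 0 < w i)
    {N : ℤ} {f : MvPolynomial (Fin n) 𝕜} (hf : IsQuasihomogeneous w N f)
    (hf0 : MvPolynomial.eval 0 f = 0) (hne : f ≠ 0) : 0 < N := by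
  obtain ⟨d, hd⟩ := MvPolynomial.ne_zero_iff.1 hne
  have h0 : d ≠ 0 := by
    rintro rfl
    apply hd
    rw [← MvPolynomial.constantCoeff_eq, ← MvPolynomial.eval_zero]
    exact hf0
  obtain ⟨i, hi⟩ := Finsupp.ne_iff.1 h0
  have key := congrArg (fun p : MvPolynomial (Fin n) 𝕜 =>
    MvPowerSeries.coeff d (MvPolynomial.coeToMvPowerSeries.ringHom p)) hf
  simp only [map_sum, map_mul, map_natCast, map_intCast,
    MvPolynomial.coeToMvPowerSeries.ringHom_apply, MvPolynomial.coe_X,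
    ← MvPowerSeries.pderiv_coe] at key
  rw [← map_sum, coeff_weighted_euler] at key
  have hc : (N : MvPowerSeries (Fin n) 𝕜) = MvPowerSeries.C (N : 𝕜) := by simp
  rw [hc, MvPowerSeries.coeff_C_mul, MvPolynomial.coeff_coe] at key
  have hN : ((∑ i, w i * d i : ℕ) : ℤ) = N := by
    have := mul_right_cancel₀ hd key
    exact_mod_cast this
  rw [← hN]
  have : 0 < ∑ i, w i * d i := Finset.sum_pos' (fun _ _ => Nat.zero_le _)
    ⟨i, Finset.mem_univ _, Nat.mul_pos (hw i) (Nat.pos_of_ne_zero hi)⟩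
  exact_mod_cast this

theorem orderEmbedding_fin_eq_refl {n : ℕ} (J : Fin n ↪o Fin n) : J = RelEmbedding.refl _ := by
  refine DFunLike.coe_injective ((J.strictMono.range_inj strictMono_id).1 ?_)
  rw [(Finite.surjective_of_injective J.injective).range_eq, Set.range_id]

theorem dropIndex_refl {m : ℕ} (j : Fin (m + 1)) :
    dropIndex (RelEmbedding.refl _) j = Fin.succAboveOrderEmb j := by
  ext; rfl

theorem derivation_neg_one_pow_mul (D : Derivation 𝕜 R R) (k : ℕ) (a : R) :
    D ((-1) ^ k * a) = (-1) ^ k * D a := by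
  rcases neg_one_pow_eq_or R k with h | h <;> simp [h]

/-- The top-degree form `f div X + c X(f)`, read as a function, for the vector field
`X = ∑ Xᵢ ∂ᵢ`. -/
def twistedDivergence {m : ℕ} (D : Fin m → Derivation 𝕜 R R) (f : R) (c : ℕ) (X : Fin m → R) : R :=
  ∑ j, (f * D j (X j) + c * (D j f * X j))

/-- The signs of the exterior derivative are absorbed into the components of the vector field, and
the coefficient `-(m - p)` of `df ∧ α` is `c`. -/
theorem dOp_refl_apply {m : ℕ} (D : Fin (m + 1) → Derivation 𝕜 R R) (f : R) {p : ℤ} {c : ℕ}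
    (hc : (c : ℤ) = p - m) (α : Form R (m + 1) m) :
    dOp D f p m α (RelEmbedding.refl _)
      = twistedDivergence D f c fun j => (-1) ^ (j : ℕ) * α (Fin.succAboveOrderEmb j) := by
  have hc' : ((m : ℤ) - p) = -(c : ℤ) := by omega
  simp only [dOp, LinearMap.sub_apply, LinearMap.comp_apply, LinearMap.smul_apply, Pi.sub_apply,
    Pi.smul_apply, LinearMap.compLeft_apply, extD, wedge1, LinearMap.coe_mk, AddHom.coe_mk,
    Function.comp_apply, LinearMap.mulLeft_apply, twistedDivergence, derivation_neg_one_pow_mul, hc',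
    dropIndex_refl, RelEmbedding.refl_apply]
  rw [neg_smul, sub_neg_eq_add, natCast_zsmul, nsmul_eq_mul, Finset.mul_sum, Finset.mul_sum,
    ← Finset.sum_add_distrib]
  refine Finset.sum_congr rfl fun j _ => ?_
  ring

theorem mem_coboundaries_iff {m : ℕ} (D : Fin (m + 1) → Derivation 𝕜 R R) (f : R) {p : ℤ} {c : ℕ}
    (hc : (c : ℤ) = p - m) (β : Form R (m + 1) (m + 1)) :
    β ∈ coboundaries D f p (m + 1)
      ↔ ∃ X, twistedDivergence D f c X = β (RelEmbedding.refl _) := by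
  constructor
  · rintro ⟨α, rfl⟩
    exact ⟨_, (dOp_refl_apply D f hc α).symm⟩
  · rintro ⟨X, hX⟩
    have hinj : Function.Injective fun j : Fin (m + 1) => Fin.succAboveOrderEmb j := by
      intro i j h
      refine Fin.succAbove_left_injective (funext fun k => ?_)
      exact DFunLike.congr_fun h k
    -- The multi-indices omitting one entry are pairwise distinct, so `α` can be prescribed on them;
    -- the default `0` never enters the formula.
    refine ⟨Function.extend (fun j : Fin (m + 1) => Fin.succAboveOrderEmb j)
      (fun j => (-1) ^ (j : ℕ) * X j) 0, ?_⟩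
    funext J
    rw [orderEmbedding_fin_eq_refl J, dOp_refl_apply D f hc, ← hX]
    congr 1
    funext j
    rw [hinj.extend_apply, ← mul_assoc, ← mul_pow]
    simp

theorem twistedDivergence_sub {m : ℕ} (D : Fin m → Derivation 𝕜 R R) (f : R) (c : ℕ)
    (X Y : Fin m → R) :
    twistedDivergence D f c (X - Y) = twistedDivergence D f c X - twistedDivergence D f c Y := by
  simp only [twistedDivergence, ← Finset.sum_sub_distrib, Pi.sub_apply, map_sub]
  exact Finset.sum_congr rfl fun j _ => by ring

/-- Combines `div (g W) = W g + (∑ wᵢ) g` with `W f = N f`: the Euler direction produces exactly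
multiples of `f`. -/
theorem twistedDivergence_euler {m : ℕ} (D : Fin m → Derivation 𝕜 R R) {f : R} (c : ℕ)
    {x : Fin m → R} (hx : ∀ i, D i (x i) = 1) {w : Fin m → ℕ} {N : ℕ}
    (hf : ∑ i, (w i : R) * x i * D i f = N * f) (g : R) :
    twistedDivergence D f c (fun i => g * ((w i : R) * x i))
      = f * (∑ i, (w i : R) * x i * D i g + (∑ i, w i + c * N : ℕ) * g) := by
  have h : ∀ i, D i (g * ((w i : R) * x i)) = g * w i + (w i : R) * x i * D i g := by
    intro i
    simp [Derivation.leibniz, hx]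
  have hs : twistedDivergence D f c (fun i => g * ((w i : R) * x i))
      = f * ∑ i, (w i : R) * x i * D i g + f * (g * ∑ i, (w i : R))
        + c * g * ∑ i, (w i : R) * x i * D i f := by
    simp only [twistedDivergence, h, Finset.mul_sum, ← Finset.sum_add_distrib]
    exact Finset.sum_congr rfl fun j _ => by ring
  rw [hs, hf]
  push_cast
  ring

theorem exists_twistedDivergence_eq_iff [CharZero 𝕜] {m : ℕ}
    (D : Fin m → Derivation 𝕜 R R) {f : R}
    {x : Fin m → R} (hx : ∀ i, D i (x i) = 1) {w : Fin m → ℕ} {N : ℕ}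
    (hf : ∑ i, (w i : R) * x i * D i f = N * f) (hN : 0 < N) {c : ℕ} (hc : 0 < c)
    (hsurj : ∀ l : ℕ, 0 < l → ∀ h : R, ∃ g : R, ∑ i, (w i : R) * x i * D i g + l * g = h) (r : R) :
    (∃ X, twistedDivergence D f c X = r) ↔ r ∈ jacobianIdeal D f := by
  have hD : ∀ i, D i f ∈ jacobianIdeal D f := fun i => Ideal.subset_span ⟨i, rfl⟩
  have hinv : ∀ k : ℕ, 0 < k → ∀ a : R, (k : R) * (algebraMap 𝕜 R (k : 𝕜)⁻¹ * a) = a := by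
    intro k hk a
    have hk' : (k : 𝕜) ≠ 0 := by exact_mod_cast hk.ne'
    rw [← mul_assoc, ← map_natCast (algebraMap 𝕜 R), ← map_mul, mul_inv_cancel₀ hk', map_one,
      one_mul]
  have hfJ : f ∈ jacobianIdeal D f := by
    have h1 : (N : R) * f ∈ jacobianIdeal D f := by
      rw [← hf]
      exact Ideal.sum_mem _ fun i _ => Ideal.mul_mem_left _ _ (hD i)
    have h2 := Ideal.mul_mem_left _ (algebraMap 𝕜 R (N : 𝕜)⁻¹) h1
    rwa [mul_left_comm, hinv N hN] at h2
  have hl : 0 < ∑ i, w i + c * N := Nat.add_pos_right _ (Nat.mul_pos hc hN)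
  constructor
  · rintro ⟨X, rfl⟩
    exact Ideal.sum_mem _ fun i _ => Ideal.add_mem _ (Ideal.mul_mem_right _ _ hfJ)
      (Ideal.mul_mem_left _ _ (Ideal.mul_mem_right _ _ (hD i)))
  · intro hr
    obtain ⟨a, rfl⟩ := (Ideal.mem_span_range_iff_exists_fun).1 hr
    -- Dividing by `c` makes `c Y(f)` the prescribed element, leaving the error `f div Y` for the
    -- Euler field to cancel.
    let Y : Fin m → R := fun i => algebraMap 𝕜 R (c : 𝕜)⁻¹ * a i
    obtain ⟨g, hg⟩ := hsurj _ hl (∑ j, D j (Y j))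
    refine ⟨Y - fun i => g * ((w i : R) * x i), ?_⟩
    rw [twistedDivergence_sub, twistedDivergence_euler D c hx hf, hg, twistedDivergence,
      Finset.sum_add_distrib, ← Finset.mul_sum, add_sub_cancel_left]
    refine Finset.sum_congr rfl fun i _ => ?_
    rw [mul_left_comm, hinv c hc, mul_comm]

theorem nonempty_cohomology_equiv_milnorAlgebra [CharZero 𝕜] {m : ℕ}
    (D : Fin (m + 1) → Derivation 𝕜 R R) (φ : MvPolynomial (Fin (m + 1)) 𝕜 →ₐ[𝕜] R)
    (hφ : ∀ i j, D i (φ (MvPolynomial.X j)) = if i = j then 1 else 0)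
    {w : Fin (m + 1) → ℕ} (hw : ∀ i, 0 < w i)
    (hsurj : ∀ l : ℕ, 0 < l → ∀ h : R,
      ∃ g : R, ∑ i, (w i : R) * φ (MvPolynomial.X i) * D i g + l * g = h)
    {N : ℤ} {f : MvPolynomial (Fin (m + 1)) 𝕜} (hf : IsQuasihomogeneous w N f)
    (hf0 : MvPolynomial.eval 0 f = 0) {q : ℤ} (hq : q ≤ 0) :
    Nonempty (Cohomology R D (φ f) (((m + 1 : ℕ) : ℤ) - q) (m + 1)
      ≃ₗ[𝕜] MilnorAlgebra R D (φ f)) := by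
  obtain ⟨c, hc⟩ : ∃ c : ℕ, (c : ℤ) = 1 - q := ⟨(1 - q).toNat, by omega⟩
  have hc0 : 0 < c := by omega
  have hcp : (c : ℤ) = (((m + 1 : ℕ) : ℤ) - q) - m := by push_cast; omega
  have hmem : ∀ r : R, (∃ X, twistedDivergence D (φ f) c X = r) ↔ r ∈ jacobianIdeal D (φ f) := by
    -- For `f = 0` the degree `N` is not determined, but the image and the Jacobian ideal are both
    -- zero.
    by_cases hne : f = 0
    · subst hne
      intro r
      have : jacobianIdeal D (0 : R) = ⊥ := by
        rw [jacobianIdeal, Ideal.span_eq_bot]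
        rintro _ ⟨i, rfl⟩
        exact map_zero _
      simp [twistedDivergence, this, eq_comm]
    · have hN := hf.degree_pos hw hf0 hne
      lift N to ℕ using hN.le
      refine exists_twistedDivergence_eq_iff D (x := fun i => φ (MvPolynomial.X i))
        (fun i => by simp [hφ]) (N := N) ?_ (by exact_mod_cast hN) hc0 hsurj
      have h := congrArg φ hf
      simp only [map_sum, map_mul, map_natCast, Int.cast_natCast,
        ← derivation_algHom_eq_pderiv φ _ (D _) (hφ _)] at h
      exact h
  let ev : cocycles D (φ f) (((m + 1 : ℕ) : ℤ) - q) (m + 1) →ₗ[𝕜] R :=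
    LinearMap.proj (RelEmbedding.refl _) ∘ₗ Submodule.subtype _
  let L := (Ideal.Quotient.mkₐ 𝕜 (jacobianIdeal D (φ f))).toLinearMap ∘ₗ ev
  -- There are no forms above the top degree, so every top form is a cocycle.
  have hempty : IsEmpty (Fin (m + 1 + 1) ↪o Fin (m + 1)) :=
    ⟨fun J => by simpa using Fintype.card_le_of_injective J J.injective⟩
  have hL : Function.Surjective L := by
    intro y
    obtain ⟨r, rfl⟩ := Ideal.Quotient.mk_surjective y
    exact ⟨⟨fun _ => r, LinearMap.mem_ker.2 (Subsingleton.elim _ _)⟩, rfl⟩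
  have hker : (coboundaries D (φ f) (((m + 1 : ℕ) : ℤ) - q) (m + 1)).comap
      (cocycles D (φ f) (((m + 1 : ℕ) : ℤ) - q) (m + 1)).subtype = LinearMap.ker L := by
    ext z
    rw [Submodule.mem_comap, mem_coboundaries_iff D (φ f) hcp, hmem, LinearMap.mem_ker]
    exact Ideal.Quotient.eq_zero_iff_mem.symm
  exact ⟨(Submodule.quotEquivOfEq _ _ hker).trans (L.quotKerEquivOfSurjective hL)⟩

end Algebra


/-! ### Solving the Euler equation by averaging over weighted dilations -/

section Averaging

open MeasureTheory

/-- The weighted dilation `x ↦ (t ^ wᵢ xᵢ)ᵢ` of `𝕜ⁿ`. -/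
noncomputable def dilation {𝕜 : Type*} [NontriviallyNormedField 𝕜] {n : ℕ} (w : Fin n → ℕ) (t : 𝕜) :
    (Fin n → 𝕜) →L[𝕜] (Fin n → 𝕜) :=
  ContinuousLinearMap.pi fun i => t ^ w i • ContinuousLinearMap.proj i

variable {𝕜 : Type*} [RCLike 𝕜] {n : ℕ}

theorem dilation_apply (w : Fin n → ℕ) (t : 𝕜) (x : Fin n → 𝕜) (i : Fin n) :
    dilation w t x i = t ^ w i * x i := rfl

theorem dilation_dilation (w : Fin n → ℕ) (s t : 𝕜) (x : Fin n → 𝕜) :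
    dilation w s (dilation w t x) = dilation w (t * s) x := by
  ext i
  simp only [dilation_apply, mul_pow]
  ring

theorem dilation_one (w : Fin n → ℕ) (x : Fin n → 𝕜) : dilation w 1 x = x := by
  ext i
  simp [dilation_apply]

theorem continuous_dilation (w : Fin n → ℕ) :
    Continuous fun t : ℝ => (dilation w (t : 𝕜) : (Fin n → 𝕜) →L[𝕜] (Fin n → 𝕜)) := by
  have h : (fun t : ℝ => (dilation w (t : 𝕜) : (Fin n → 𝕜) →L[𝕜] (Fin n → 𝕜)))
      = fun t : ℝ => ∑ i, (t : 𝕜) ^ w i • ((ContinuousLinearMap.single 𝕜 (fun _ => 𝕜) i).comp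
        (ContinuousLinearMap.proj i) : (Fin n → 𝕜) →L[𝕜] (Fin n → 𝕜)) := by
    funext t
    ext x j
    simp [dilation_apply, Finset.sum_apply, Pi.single_apply]
  rw [h]
  fun_prop

theorem norm_dilation_le (w : Fin n → ℕ) {t : ℝ} (h0 : 0 ≤ t) (h1 : t ≤ 1) :
    ‖(dilation w (t : 𝕜) : (Fin n → 𝕜) →L[𝕜] (Fin n → 𝕜))‖ ≤ 1 := by
  refine ContinuousLinearMap.opNorm_le_bound _ zero_le_one fun x => ?_
  rw [one_mul]
  refine (pi_norm_le_iff_of_nonneg (norm_nonneg _)).2 fun i => ?_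
  rw [dilation_apply, norm_mul, norm_pow, RCLike.norm_ofReal, abs_of_nonneg h0]
  exact (mul_le_of_le_one_left (norm_nonneg _) (pow_le_one₀ h0 h1)).trans (norm_le_pi_norm x i)

theorem norm_dilation_apply_le (w : Fin n → ℕ) {t : ℝ} (h0 : 0 ≤ t) (h1 : t ≤ 1) (x : Fin n → 𝕜) :
    ‖dilation w (t : 𝕜) x‖ ≤ ‖x‖ :=
  (ContinuousLinearMap.le_of_opNorm_le _ (norm_dilation_le w h0 h1) x).trans (one_mul _).le

/-- The weighted average `∫₀¹ t ^ k h(t ^ w x) dt`. -/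
noncomputable def weightedAverage (w : Fin n → ℕ) (k : ℕ) (h : (Fin n → 𝕜) → 𝕜) (x : Fin n → 𝕜) : 𝕜 :=
  ∫ t in (0 : ℝ)..1, (t : 𝕜) ^ k * h (dilation w (t : 𝕜) x)

/-- Substituting `t ↦ s t` moves the dilation parameter into the upper limit of integration, ready
for the fundamental theorem of calculus. -/
theorem pow_smul_weightedAverage_dilation (w : Fin n → ℕ) (k : ℕ) (h : (Fin n → 𝕜) → 𝕜)
    (x : Fin n → 𝕜) (s : ℝ) :
    (s : 𝕜) ^ (k + 1) * weightedAverage w k h (dilation w (s : 𝕜) x)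
      = ∫ t in (0 : ℝ)..s, (t : 𝕜) ^ k * h (dilation w (t : 𝕜) x) := by
  have := intervalIntegral.smul_integral_comp_mul_left (a := 0) (b := 1)
    (fun t : ℝ => (t : 𝕜) ^ k * h (dilation w (t : 𝕜) x)) s
  rw [mul_zero, mul_one] at this
  rw [← this, RCLike.real_smul_eq_coe_mul, pow_succ', mul_assoc, weightedAverage,
    ← intervalIntegral.integral_const_mul]
  congr 1
  refine intervalIntegral.integral_congr fun t _ => ?_
  simp only [dilation_dilation, RCLike.ofReal_mul, mul_pow]
  ring

theorem hasDerivAt_dilation (w : Fin n → ℕ) (x : Fin n → 𝕜) :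
    HasDerivAt (fun s : ℝ => dilation w (s : 𝕜) x) (fun i => (w i : 𝕜) * x i) 1 := by
  rw [hasDerivAt_pi]
  intro i
  have h := ((RCLike.ofRealCLM (K := 𝕜)).hasDerivAt (x := (1 : ℝ))).pow (w i)
  have h' := h.mul_const (x i)
  simpa [dilation_apply] using h'

/-- Both sides of `pow_smul_weightedAverage_dilation` are differentiated at `s = 1`: the product and
chain rules give the Euler operator plus `k + 1`, the integral gives its integrand at `1`. -/
theorem fderiv_weightedAverage_add {w : Fin n → ℕ} {k : ℕ} {h : (Fin n → 𝕜) → 𝕜} {r : ℝ}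
    (hh : ContinuousOn h (Metric.ball 0 r)) {x : Fin n → 𝕜} (hx : x ∈ Metric.ball 0 r)
    (hd : DifferentiableAt 𝕜 (weightedAverage w k h) x) :
    fderiv 𝕜 (weightedAverage w k h) x (fun i => (w i : 𝕜) * x i)
      + ((k + 1 : ℕ) : 𝕜) * weightedAverage w k h x = h x := by
  have hcd : Continuous fun t : ℝ => dilation w (t : 𝕜) x :=
    (continuous_dilation w).clm_apply continuous_const
  -- An open set of parameters containing `[0, 1]`: differentiating at the endpoint `1` needs
  -- continuity of the integrand on both sides of it.
  set U : Set ℝ := {t | dilation w (t : 𝕜) x ∈ Metric.ball 0 r} with hU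
  have hUo : IsOpen U := Metric.isOpen_ball.preimage hcd
  set ψ : ℝ → 𝕜 := fun t => (t : 𝕜) ^ k * h (dilation w (t : 𝕜) x) with hψ
  have hψc : ContinuousOn ψ U :=
    (RCLike.continuous_ofReal.pow k).continuousOn.mul (hh.comp hcd.continuousOn fun _ ht => ht)
  have hIU : Set.Icc (0 : ℝ) 1 ⊆ U := fun t ht => by
    rw [mem_ball_zero_iff] at hx
    exact mem_ball_zero_iff.2 ((norm_dilation_apply_le w ht.1 ht.2 x).trans_lt hx)
  have h1U : (1 : ℝ) ∈ U := hIU ⟨zero_le_one, le_rfl⟩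
  have hint : IntervalIntegrable ψ volume 0 1 :=
    (hψc.mono (by rwa [Set.uIcc_of_le zero_le_one])).intervalIntegrable
  have hI : HasDerivAt (fun s : ℝ => ∫ t in (0 : ℝ)..s, ψ t) (ψ 1) 1 :=
    intervalIntegral.integral_hasDerivAt_right hint
      (hψc.stronglyMeasurableAtFilter hUo 1 h1U) (hψc.continuousAt (hUo.mem_nhds h1U))
  have hd' : HasFDerivAt (𝕜 := ℝ) (weightedAverage w k h)
      ((fderiv 𝕜 (weightedAverage w k h) x).restrictScalars ℝ) (dilation w ((1 : ℝ) : 𝕜) x) := by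
    rw [RCLike.ofReal_one, dilation_one]
    exact hd.hasFDerivAt.restrictScalars ℝ
  have hG := (((RCLike.ofRealCLM (K := 𝕜)).hasDerivAt (x := (1 : ℝ))).pow (k + 1)).mul
    (hd'.comp_hasDerivAt (1 : ℝ) (hasDerivAt_dilation w x))
  have hG' : HasDerivAt (fun s : ℝ => ∫ t in (0 : ℝ)..s, ψ t) _ 1 :=
    hG.congr_of_eventuallyEq (Eventually.of_forall fun s =>
      (pow_smul_weightedAverage_dilation w k h x s).symm)
  have := hI.unique hG'
  simp [hψ, dilation_one] at this
  rw [this]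
  push_cast
  ring

end Averaging

/-! ### Smoothness of the average -/

section Smooth

universe u

theorem hasFDerivAt_intervalIntegral_of_contDiff {E G : Type u} [NormedAddCommGroup E]
    [NormedSpace ℝ E] [FiniteDimensional ℝ E] [NormedAddCommGroup G] [NormedSpace ℝ G]
    {F : E × ℝ → G} (hF : ContDiff ℝ 1 F) (a b : ℝ) (x : E) :
    HasFDerivAt (fun x => ∫ t in a..b, F (x, t))
      (∫ t in a..b, (fderiv ℝ F (x, t)).comp (ContinuousLinearMap.inl ℝ E ℝ)) x := by
  have hc : Continuous fun p : E × ℝ => (fderiv ℝ F p).comp (ContinuousLinearMap.inl ℝ E ℝ) :=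
    (hF.continuous_fderiv one_ne_zero).clm_comp continuous_const
  have hK : IsCompact (Metric.closedBall x 1 ×ˢ Set.uIcc a b) :=
    have := FiniteDimensional.proper ℝ E
    (isCompact_closedBall x 1).prod isCompact_uIcc
  obtain ⟨C, hC⟩ := hK.exists_bound_of_continuousOn hc.continuousOn
  refine intervalIntegral.hasFDerivAt_integral_of_dominated_of_fderiv_le
    (F := fun x t => F (x, t)) (bound := fun _ => C)
    (F' := fun x t => (fderiv ℝ F (x, t)).comp (ContinuousLinearMap.inl ℝ E ℝ))
    (Metric.closedBall_mem_nhds x one_pos) ?_ ?_ ?_ ?_ ?_ ?_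
  · exact Eventually.of_forall fun y =>
      (hF.continuous.comp (by fun_prop : Continuous fun t : ℝ => (y, t))).aestronglyMeasurable
  · exact (hF.continuous.comp (by fun_prop : Continuous fun t : ℝ => (x, t))).intervalIntegrable _ _
  · exact (hc.comp (by fun_prop : Continuous fun t : ℝ => (x, t))).aestronglyMeasurable
  · exact Eventually.of_forall fun t ht y hy => hC (y, t) ⟨hy, Set.uIoc_subset_uIcc ht⟩
  · exact intervalIntegrable_const
  · refine Eventually.of_forall fun t _ y _ => ?_
    exact ((hF.differentiable one_ne_zero) (y, t)).hasFDerivAt.comp y (hasFDerivAt_prodMk_left y t)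

/-- Induction by differentiating under the integral. The target `G` varies because the derivative
takes values in `E →L[ℝ] G`; sharing one universe keeps that space within the induction. -/
theorem contDiff_intervalIntegral {E : Type u} [NormedAddCommGroup E]
    [NormedSpace ℝ E] [FiniteDimensional ℝ E] (a b : ℝ) (k : ℕ) :
    ∀ {G : Type u} [NormedAddCommGroup G] [NormedSpace ℝ G] {F : E × ℝ → G},
      ContDiff ℝ k F → ContDiff ℝ k fun x => ∫ t in a..b, F (x, t) := by
  induction k with
  | zero =>
    intro G _ _ F hF
    rw [Nat.cast_zero, contDiff_zero] at hF ⊢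
    exact intervalIntegral.continuous_parametric_intervalIntegral_of_continuous'
      (f := fun x t => F (x, t)) hF a b
  | succ k ih =>
    intro G _ _ F hF
    refine contDiff_succ_iff_hasFDerivAt.2 ⟨_, ih (F := fun p =>
      (fderiv ℝ F p).comp (ContinuousLinearMap.inl ℝ E ℝ)) ?_,
      hasFDerivAt_intervalIntegral_of_contDiff (hF.of_le (by simp)) a b⟩
    exact (hF.fderiv_right (m := k) (by simp)).clm_comp contDiff_const

theorem contDiff_weightedAverage {n : ℕ} (w : Fin n → ℕ) (k : ℕ) {h : (Fin n → ℝ) → ℝ}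
    (hh : ContDiff ℝ ∞ h) : ContDiff ℝ ∞ (weightedAverage w k h) := by
  refine contDiff_infty.2 fun l => ?_
  refine contDiff_intervalIntegral 0 1 l
    (F := fun p : (Fin n → ℝ) × ℝ => p.2 ^ k * h (dilation w p.2 p.1)) ?_
  refine (contDiff_snd.pow k).mul ((contDiff_infty.1 hh l).comp (contDiff_pi.2 fun i => ?_))
  simp only [dilation_apply]
  fun_prop

/-- Multiplying by a bump function gives a globally smooth representative, so that the parametric
integral is smooth everywhere. -/
theorem exists_contDiff_eventuallyEq {n : ℕ} {h : (Fin n → ℝ) → ℝ}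
    (hh : ∀ᶠ x in 𝓝 (0 : Fin n → ℝ), ContDiffAt ℝ ∞ h x) :
    ∃ h' : (Fin n → ℝ) → ℝ, ContDiff ℝ ∞ h' ∧ h' =ᶠ[𝓝 0] h := by
  obtain ⟨r, hr, hrh⟩ := Metric.eventually_nhds_iff_ball.1 hh
  let χ : ContDiffBump (0 : Fin n → ℝ) := ⟨r / 4, r / 2, by linarith, by linarith⟩
  refine ⟨fun x => χ x * h x, contDiff_iff_contDiffAt.2 fun x => ?_, ?_⟩
  · by_cases hx : x ∈ tsupport fun x => χ x * h x
    swap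
    · exact contDiffAt_const.congr_of_eventuallyEq (notMem_tsupport_iff_eventuallyEq.1 hx)
    have hx' : x ∈ tsupport χ := tsupport_mul_subset_left hx
    rw [χ.tsupport_eq] at hx'
    exact χ.contDiff.contDiffAt.mul
      (hrh x (Metric.closedBall_subset_ball (by change r / 2 < r; linarith) hx'))
  · filter_upwards [χ.eventuallyEq_one] with x hx
    simp [hx]

end Smooth

/-! ### Analyticity of the average, over `ℝ` and `ℂ` alike -/

section Analytic

open MeasureTheory

variable {𝕜 : Type*} [RCLike 𝕜] {n : ℕ}

/-- The power series of `h` is averaged term by term. Dilations with `t ∈ [0, 1]` have norm at most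
one, so the radius does not shrink and dominated convergence permits exchanging sum and integral. -/
theorem analyticAt_weightedAverage (w : Fin n → ℕ) (k : ℕ) {h : (Fin n → 𝕜) → 𝕜}
    (hh : AnalyticAt 𝕜 h 0) : AnalyticAt 𝕜 (weightedAverage w k h) 0 := by
  obtain ⟨p, r, hp⟩ := hh
  let F : ∀ l : ℕ, ℝ → ContinuousMultilinearMap 𝕜 (fun _ : Fin l => Fin n → 𝕜) 𝕜 := fun l t =>
    (t : 𝕜) ^ k • (p l).compContinuousLinearMap fun _ => dilation w (t : 𝕜)
  have hFc : ∀ l, Continuous (F l) := fun l => by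
    refine ((RCLike.continuous_ofReal (K := 𝕜)).pow k).smul ?_
    exact (ContinuousMultilinearMap.compContinuousLinearMapLRight (p l)).cont.comp
      (continuous_pi fun _ => continuous_dilation w)
  have hFn : ∀ l, ∀ t ∈ Set.uIoc (0 : ℝ) 1, ‖F l t‖ ≤ ‖p l‖ := by
    intro l t ht
    rw [Set.uIoc_of_le zero_le_one] at ht
    have h1 : ‖(t : 𝕜) ^ k‖ ≤ 1 := by
      rw [norm_pow, RCLike.norm_ofReal, abs_of_nonneg ht.1.le]
      exact pow_le_one₀ ht.1.le ht.2
    have h2 : ∏ _i : Fin l, ‖(dilation w (t : 𝕜) : (Fin n → 𝕜) →L[𝕜] (Fin n → 𝕜))‖ ≤ 1 :=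
      Finset.prod_le_one (fun _ _ => norm_nonneg _) fun _ _ => norm_dilation_le w ht.1.le ht.2
    rw [norm_smul]
    refine (mul_le_of_le_one_left (norm_nonneg _) h1).trans ?_
    exact (ContinuousMultilinearMap.norm_compContinuousLinearMap_le _ _).trans
      (mul_le_of_le_one_right (norm_nonneg _) h2)
  let q : FormalMultilinearSeries 𝕜 (Fin n → 𝕜) 𝕜 := fun l => ∫ t in (0 : ℝ)..1, F l t
  have hq : p.radius ≤ q.radius := FormalMultilinearSeries.radius_le_of_le fun l => by
    refine (intervalIntegral.norm_integral_le_of_norm_le_const (hFn l)).trans ?_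
    simp
  refine ⟨q, r, hp.r_le.trans hq, hp.r_pos, fun {y} hy => ?_⟩
  have hqy : ∀ l, (q l fun _ => y) = ∫ t in (0 : ℝ)..1, F l t fun _ => y := fun l =>
    ((ContinuousMultilinearMap.apply 𝕜 (fun _ : Fin l => Fin n → 𝕜) 𝕜
      fun _ => y).intervalIntegral_comp_comm ((hFc l).intervalIntegrable 0 1)).symm
  have hyr : ‖y‖ₑ < p.radius := by
    have : ‖y‖ₑ < r := by simpa using hy
    exact this.trans_le hp.r_le
  have hsum : Summable fun l => ‖p l‖ * ‖y‖ ^ l := p.summable_norm_mul_pow (r := ‖y‖₊) hyr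
  simp only [hqy, zero_add]
  refine intervalIntegral.hasSum_integral_of_dominated_convergence
    (fun l _ => ‖p l‖ * ‖y‖ ^ l) (fun l => ?_) (fun l => ?_) ?_ ?_ ?_
  · exact ((ContinuousMultilinearMap.apply 𝕜 (fun _ : Fin l => Fin n → 𝕜) 𝕜
      fun _ => y).continuous.comp (hFc l)).aestronglyMeasurable
  · refine Eventually.of_forall fun t ht => ?_
    refine ((F l t).le_opNorm _).trans ?_
    rw [Finset.prod_const, Finset.card_univ, Fintype.card_fin]
    exact mul_le_mul_of_nonneg_right (hFn l t ht) (by positivity)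
  · exact Eventually.of_forall fun _ _ => hsum
  · exact intervalIntegrable_const
  · refine Eventually.of_forall fun t ht => ?_
    rw [Set.uIoc_of_le zero_le_one] at ht
    have hmem : dilation w (t : 𝕜) y ∈ Metric.eball (0 : Fin n → 𝕜) r := by
      have h1 : ‖y‖ₑ < r := by simpa using hy
      have h2 : ‖dilation w (t : 𝕜) y‖ₑ ≤ ‖y‖ₑ :=
        enorm_le_iff_norm_le.2 (norm_dilation_apply_le w ht.1.le ht.2 y)
      simpa using h2.trans_lt h1
    have := (hp.hasSum hmem).mul_left ((t : 𝕜) ^ k)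
    rw [zero_add] at this
    exact this

end Analytic


/-! ### Transfer to germs and conclusion -/

section Germs

/-- `analyticGerm` as a homomorphism of algebras. -/
noncomputable def analyticGermHom (𝕜 : Type*) [NontriviallyNormedField 𝕜] [CompleteSpace 𝕜] (n : ℕ) :
    MvPolynomial (Fin n) 𝕜 →ₐ[𝕜] AnalyticGerms 𝕜 n :=
  AlgHom.ofLinearMap
    { toFun := analyticGerm
      map_add' := fun p q => Subtype.ext (Germ.coe_eq.2 (Eventually.of_forall fun x => by simp))
      map_smul' := fun c p => Subtype.ext (Germ.coe_eq.2 (Eventually.of_forall fun x => by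
        simp [MvPolynomial.smul_eval])) }
    (Subtype.ext (Germ.coe_eq.2 (Eventually.of_forall fun x => by simp)))
    fun p q => Subtype.ext (Germ.coe_eq.2 (Eventually.of_forall fun x => by simp))

/-- `smoothGerm` as a homomorphism of algebras. -/
noncomputable def smoothGermHom (n : ℕ) : MvPolynomial (Fin n) ℝ →ₐ[ℝ] SmoothGerms n :=
  AlgHom.ofLinearMap
    { toFun := smoothGerm
      map_add' := fun p q => Subtype.ext (Germ.coe_eq.2 (Eventually.of_forall fun x => by simp))
      map_smul' := fun c p => Subtype.ext (Germ.coe_eq.2 (Eventually.of_forall fun x => by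
        simp [MvPolynomial.smul_eval])) }
    (Subtype.ext (Germ.coe_eq.2 (Eventually.of_forall fun x => by simp)))
    fun p q => Subtype.ext (Germ.coe_eq.2 (Eventually.of_forall fun x => by simp))

theorem germPderiv_eval_X {𝕜 : Type*} [NontriviallyNormedField 𝕜] {n : ℕ} (i j : Fin n) :
    germPderiv i ((fun x => MvPolynomial.eval x (MvPolynomial.X j) : (Fin n → 𝕜) → 𝕜) : AllGerms 𝕜 n)
      = if i = j then 1 else 0 := by
  rw [germPderiv_coe]
  have h : ∀ x : Fin n → 𝕜, fderiv 𝕜 (fun x : Fin n → 𝕜 => x j) x (Pi.single i 1)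
      = if i = j then 1 else 0 := by
    intro x
    rw [(hasFDerivAt_apply j x).fderiv]
    simp [Pi.single_apply, eq_comm]
  simp only [MvPolynomial.eval_X, h]
  split_ifs <;> rfl

theorem analyticPderiv_analyticGermHom_X {𝕜 : Type*} [NontriviallyNormedField 𝕜] [CompleteSpace 𝕜]
    {n : ℕ} (i j : Fin n) :
    analyticPderiv 𝕜 i (analyticGermHom 𝕜 n (MvPolynomial.X j)) = if i = j then 1 else 0 := by
  refine Subtype.ext ((germPderiv_eval_X i j).trans ?_)
  split_ifs <;> rfl

theorem smoothPderiv_smoothGermHom_X {n : ℕ} (i j : Fin n) :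
    smoothPderiv i (smoothGermHom n (MvPolynomial.X j)) = if i = j then 1 else 0 := by
  refine Subtype.ext ((germPderiv_eval_X i j).trans ?_)
  split_ifs <;> rfl

theorem weighted_euler_germ_eq {𝕜 : Type*} [NontriviallyNormedField 𝕜] {n : ℕ} (w : Fin n → ℕ) (l : ℕ)
    {g h : (Fin n → 𝕜) → 𝕜}
    (hgh : ∀ᶠ x in 𝓝 (0 : Fin n → 𝕜), fderiv 𝕜 g x (fun i => (w i : 𝕜) * x i) + l * g x = h x) :
    ∑ i, (w i : AllGerms 𝕜 n) * ((fun x => MvPolynomial.eval x (MvPolynomial.X i) : (Fin n → 𝕜) → 𝕜)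
      : AllGerms 𝕜 n) * germPderiv i (g : AllGerms 𝕜 n) + l * (g : AllGerms 𝕜 n) = h := by
  have hs : ∑ i, (w i : AllGerms 𝕜 n) * ((fun x => MvPolynomial.eval x (MvPolynomial.X i) :
        (Fin n → 𝕜) → 𝕜) : AllGerms 𝕜 n) * germPderiv i (g : AllGerms 𝕜 n)
      = ((∑ i, fun x => (w i : 𝕜) * x i * fderiv 𝕜 g x (Pi.single i 1) : (Fin n → 𝕜) → 𝕜) :
        AllGerms 𝕜 n) := by
    rw [← Germ.coe_coeRingHom, map_sum]
    refine Finset.sum_congr rfl fun i _ => ?_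
    rw [Germ.coe_coeRingHom, germPderiv_coe]
    simp only [MvPolynomial.eval_X]
    rfl
  rw [hs]
  refine Germ.coe_eq.2 ?_
  filter_upwards [hgh] with x hx
  rw [← hx]
  -- Expanding the Euler vector in the standard basis turns the directional derivative into partial
  -- derivatives.
  have hv : (fun i => (w i : 𝕜) * x i)
      = ∑ i, ((w i : 𝕜) * x i) • (Pi.single i 1 : Fin n → 𝕜) := by
    ext j
    simp [Finset.sum_apply, Pi.single_apply]
  rw [hv, map_sum]
  simp only [map_smul, smul_eq_mul, Finset.sum_apply]
  rfl

theorem exists_weighted_euler_add_analytic {𝕜 : Type*} [RCLike 𝕜] {n : ℕ} (w : Fin n → ℕ) {l : ℕ}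
    (hl : 0 < l) (h : AnalyticGerms 𝕜 n) :
    ∃ g : AnalyticGerms 𝕜 n, ∑ i, (w i : AnalyticGerms 𝕜 n)
      * analyticGermHom 𝕜 n (MvPolynomial.X i) * analyticPderiv 𝕜 i g + l * g = h := by
  -- The average with weight `t ^ k` solves the equation with constant `k + 1`, whence `k = l - 1`.
  obtain ⟨k, rfl⟩ := Nat.exists_eq_add_of_le' (Nat.one_le_iff_ne_zero.2 hl.ne')
  obtain ⟨_, h, hh, rfl⟩ := h
  have hg := analyticAt_weightedAverage w k hh
  refine ⟨⟨_, _, hg, rfl⟩, Subtype.ext ?_⟩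
  obtain ⟨r, hr, hhr⟩ := Metric.eventually_nhds_iff_ball.1 hh.eventually_analyticAt
  have key := weighted_euler_germ_eq w (k + 1) (g := weightedAverage w k h) (h := h) ?_
  · push_cast at key ⊢
    exact key
  filter_upwards [hg.eventually_analyticAt, Metric.ball_mem_nhds _ hr] with x hx hxr
  exact fderiv_weightedAverage_add (fun y hy => (hhr y hy).continuousAt.continuousWithinAt) hxr
    hx.differentiableAt

theorem exists_weighted_euler_add_smooth {n : ℕ} (w : Fin n → ℕ) {l : ℕ}
    (hl : 0 < l) (h : SmoothGerms n) :
    ∃ g : SmoothGerms n, ∑ i, (w i : SmoothGerms n)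
      * smoothGermHom n (MvPolynomial.X i) * smoothPderiv i g + l * g = h := by
  obtain ⟨k, rfl⟩ := Nat.exists_eq_add_of_le' (Nat.one_le_iff_ne_zero.2 hl.ne')
  obtain ⟨_, h₀, hh₀, rfl⟩ := h
  obtain ⟨h, hh, heq⟩ := exists_contDiff_eventuallyEq hh₀
  have hg := contDiff_weightedAverage w k hh
  refine ⟨⟨_, _, Eventually.of_forall fun _ => hg.contDiffAt, rfl⟩, Subtype.ext ?_⟩
  have key := (weighted_euler_germ_eq w (k + 1) (g := weightedAverage w k h) (h := h) ?_).trans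
    (Germ.coe_eq.2 heq)
  · push_cast at key ⊢
    exact key
  filter_upwards [Metric.ball_mem_nhds _ one_pos] with x hx
  exact fderiv_weightedAverage_add hh.continuous.continuousOn hx (hg.differentiable (by simp) x)

end Germs

end NambuPoisson

open NambuPoisson in
theorem mainTheorem12 {𝕜 : Type*} [RCLike 𝕜] (n : ℕ) (hn : 3 ≤ n)
    (w : Fin n → ℕ) (hw : ∀ i, 0 < w i) (N q : ℤ) (hq : q ≤ 0) :
    -- formal case
    (∀ f : MvPolynomial (Fin n) 𝕜, IsQuasihomogeneous w N f → MvPolynomial.eval 0 f = 0 →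
      FiniteDimensional 𝕜
        (MilnorAlgebra (MvPowerSeries (Fin n) 𝕜) (MvPowerSeries.pderiv 𝕜) f) →
      Nonempty (Cohomology (MvPowerSeries (Fin n) 𝕜) (MvPowerSeries.pderiv 𝕜) f (n - q) n
        ≃ₗ[𝕜] MilnorAlgebra (MvPowerSeries (Fin n) 𝕜) (MvPowerSeries.pderiv 𝕜) f)) ∧
    -- analytic case (holomorphic if `𝕜 = ℂ`)
    (∀ f : MvPolynomial (Fin n) 𝕜, IsQuasihomogeneous w N f → MvPolynomial.eval 0 f = 0 →
      FiniteDimensional 𝕜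
        (MilnorAlgebra (AnalyticGerms 𝕜 n) (analyticPderiv 𝕜) (analyticGerm f)) →
      Nonempty (Cohomology (AnalyticGerms 𝕜 n) (analyticPderiv 𝕜) (analyticGerm f) (n - q) n
        ≃ₗ[𝕜] MilnorAlgebra (AnalyticGerms 𝕜 n) (analyticPderiv 𝕜) (analyticGerm f))) ∧
    -- real `C^∞` case
    (∀ f : MvPolynomial (Fin n) ℝ, IsQuasihomogeneous w N f → MvPolynomial.eval 0 f = 0 →
      FiniteDimensional ℝ (MilnorAlgebra (SmoothGerms n) smoothPderiv (smoothGerm f)) →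
      Nonempty (Cohomology (SmoothGerms n) smoothPderiv (smoothGerm f) (n - q) n
        ≃ₗ[ℝ] MilnorAlgebra (SmoothGerms n) smoothPderiv (smoothGerm f))) := by
  obtain ⟨m, rfl⟩ : ∃ m, n = m + 1 := ⟨n - 1, by omega⟩
  refine ⟨fun f hf hf0 _ => ?_, fun f hf hf0 _ => ?_, fun f hf hf0 _ => ?_⟩
  · have h := nonempty_cohomology_equiv_milnorAlgebra (MvPowerSeries.pderiv 𝕜)
      (MvPolynomial.coeToMvPowerSeries.algHom 𝕜)
      (fun i j => by simp [MvPowerSeries.pderiv_X, Pi.single_apply, eq_comm]) hw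
      (fun l hl h => by simpa using exists_weighted_euler_add_formal w hl h) hf hf0 hq
    have hφ : MvPolynomial.coeToMvPowerSeries.algHom 𝕜 f = (f : MvPowerSeries (Fin (m + 1)) 𝕜) := by
      simp
    rwa [hφ] at h
  · exact nonempty_cohomology_equiv_milnorAlgebra (analyticPderiv 𝕜) (analyticGermHom 𝕜 (m + 1))
      analyticPderiv_analyticGermHom_X hw
      (fun _ hl => exists_weighted_euler_add_analytic w hl) hf hf0 hq
  · exact nonempty_cohomology_equiv_milnorAlgebra smoothPderiv (smoothGermHom (m + 1))
      smoothPderiv_smoothGermHom_X hw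
      (fun _ hl => exists_weighted_euler_add_smooth w hl) hf hf0 hq
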